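/- Let $V$ be a vertex operator algebra over $\mathbb{C}$ ($\mathbb{Z}$-graded by $L(0)$-eigenvalues, with finite-dimensional weight spaces that vanish for sufficiently negative weight), with vacuum $\mathbf{1}$ and modes $Y(a,x)=\sum_{m\in\mathbb{Z}}a_m x^{-m-1}$. For $n\in\mathbb{N}$ put $$O^L(V)=\{(L(-1)+L(0))v : v\in V\},\qquad O_n^\circ(V)=\mathrm{span}\Bigl\{\mathrm{Res}_x\tfrac{(1+x)^{\mathrm{wt}\,a+n}Y(a,x)b}{x^{2n+2}} : a,b\in V,\ a \text{ homogeneous}\Bigr\},$$ $O_n(V)=O^L(V)+O_n^\circ(V)$, and let $A_n(V)=V/O_n(V)$ be the level $n$ Zhu algebra, with product induced by $$a*_nb=\sum_{m=0}^n(-1)^m\binom{m+n}{n}\mathrm{Res}_x\frac{(1+x)^{\mathrm{wt}\,a+n}Y(a,x)b}{x^{n+m+1}}$$ ($a$ homogeneous, extended linearly). Write $a\approx b$ if $a-b\in O^L(V)$ and $a\equiv_n b$ if $a-b\in O_n(V)$. For $u\in V$ let $V^u=\langle u\rangle^1=\mathrm{span}\{u_{-k_1}\cdots u_{-k_m}\mathbf{1}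 : m\ge 0,\ k_j\ge 1\}$, and for $v\in V$, $r\in\mathbb{N}$ let $F_r(v)=\mathrm{span}\{u_{-k_1}\cdots u_{-k_m}v : 0\le m\le r,\ k_j\ge 1\}$. For $X\subset V$, the algebra $V^u$ has the *permutation property* on $X$ if for all $m\ge1$, all $k_1,\dots,k_m\ge 1$, every permutation $\sigma$ of $\{1,\dots,m\}$ and every $v\in X$, $$u_{-k_1}\cdots u_{-k_m}v-u_{-k_{\sigma(1)}}\cdots u_{-k_{\sigma(m)}}v\in F_{m-1}(v).$$ $V^u$ *acts strongly* on $X$ if it has the permutation property on $X$ and $a_jw=0$ for all $a\in V^u$, $w\in X$, $j\ge0$. **Theorem.** Let $n\ge1$, and let $u\in V$ be homogeneous with $\mathrm{wt}\,u\ge -n$, such that $V^u$ is a vertex subalgebra of $V$ and has the permutation property on $V^u$. Let $W\subset V$ be a graded subspace (or, more generally, a subset each of whose elements is a linear combination of homogeneous elements of $W$) on which $V^u$ acts strongly. Let $A_n^u$ be the subalgebra of $A_n(V)$ generated by the classes of the elements of $V^u$, and let $A_n^u.W$ be the set of all classes $u_{-k_1}\cdots u_{-k_m}v+O_n(V)$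 with $v\in W$, $m\ge0$, $k_j\ge1$. Then: 1. The algebra $A_n^u$ is generated by the elements $u_{-2n}^{i_{2n}}u_{-2n+1}^{i_{2n-1}}\cdots u_{-1}^{i_1}\mathbf{1}+O_n(V)$, $i_1,\dots,i_{2n}\in\mathbb{N}$. 2. Every element of $A_n^u.W$ is a linear combination of elements $u_{-2n}^{i_{2n}}\cdots u_{-1}^{i_1}v_{-k}\mathbf{1}+O_n(V)$ with $i_1,\dots,i_{2n}\in\mathbb{N}$, $v\in W$, $k\ge1$. 3. For every homogeneous $v\in W$ and $k\ge1$, $$u_{-2n-1}v_{-k}\mathbf{1}\approx-\frac{\mathrm{wt}\,u+\mathrm{wt}\,v+2n+k-2}{2n}\,u_{-2n}v_{-k}\mathbf{1}-\frac{k}{2n}\,u_{-2n}v_{-k-1}\mathbf{1}.$$ 4. For every homogeneous $v\in W$ and all $i_1,\dots,i_{2n}\in\mathbb{N}$, $i_{2n+1}\ge1$, $k\ge1$, there is $f\in F_{i_1+\cdots+i_{2n+1}-1}(v_{-k}\mathbf{1})$ such that $$\begin{aligned} u_{-2n-1}^{i_{2n+1}}u_{-2n}^{i_{2n}}\cdots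 u_{-1}^{i_1}v_{-k}\mathbf{1}\equiv_n{}&-\frac{1}{2n(i_{2n}+1)}\Bigl(\bigl(\mathrm{wt}\,v+k-1-1+\sum_{j=1}^{2n+1}i_j(\mathrm{wt}\,u+j-1)\bigr)\,u_{-2n-1}^{i_{2n+1}-1}u_{-2n}^{i_{2n}+1}u_{-2n+1}^{i_{2n-1}}\cdots u_{-1}^{i_1}v_{-k}\mathbf{1}\\ &-(2n+1)(i_{2n+1}-1)\sum_{j=1}^{n+\mathrm{wt}\,u}\binom{n+\mathrm{wt}\,u}{j-1}u_{\mathrm{wt}\,u-n-j-1}\,u_{-2n-1}^{i_{2n+1}-2}u_{-2n}^{i_{2n}+1}u_{-2n+1}^{i_{2n-1}}\cdots u_{-1}^{i_1}v_{-k}\mathbf{1}\\ &+\sum_{j=1}^{2n-1}j\,i_j\,M_j\,v_{-k}\mathbf{1}+k\,u_{-2n-1}^{i_{2n+1}-1}u_{-2n}^{i_{2n}+1}u_{-2n+1}^{i_{2n-1}}\cdots u_{-1}^{i_1}v_{-k-1}\mathbf{1}+f\Bigr), \end{aligned}$$ where $M_j$ is obtained from the ordered monomial $u_{-2n-1}^{i_{2n+1}-1}u_{-2n}^{i_{2n}+1}u_{-2n+1}^{i_{2n-1}}\cdots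 u_{-1}^{i_1}$ by raising the exponent of $u_{-j-1}$ by one and lowering the exponent of $u_{-j}$ by one, and terms with coefficient $0$ are read as $0$ (so the sum over binomial coefficients is $0$ if $\mathrm{wt}\,u=-n$). If the operators $u_{-j}$, $j\ge1$, commute with one another, then one can take $f=0$. -/

import Mathlib

noncomputable section

/-- A vertex algebra over `ℂ`.  The state-field map `Y` takes values in Mathlib's vertex operators
(linear maps `V → V((x))`), so the truncation condition is part of the type.  The modes are given by
`Y(a, x) = ∑ a_n x^{-n-1}`, that is, `a_n = VertexOperator.ncoeff (Y a) n`.  The last field is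
the Jacobi identity, in components. -/
structure VertexAlgebra (V : Type*) [AddCommGroup V] [Module ℂ V] where
  Y : V →ₗ[ℂ] VertexOperator ℂ V
  /-- the vacuum vector -/
  vac : V
  vac_mode : ∀ (n : ℤ) (b : V), VertexOperator.ncoeff (Y vac) n b = if n = -1 then b else 0
  mode_vac_nonneg : ∀ (a : V) (n : ℤ), 0 ≤ n → VertexOperator.ncoeff (Y a) n vac = 0
  mode_vac_neg_one : ∀ a : V, VertexOperator.ncoeff (Y a) (-1) vac = a
  jacobi : ∀ (a b c : V) (p q r : ℤ),
    (∑ᶠ i : ℕ, (Ring.choose p i : ℤ) •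
        VertexOperator.ncoeff (Y (VertexOperator.ncoeff (Y a) (r + i) b)) (p + q - i) c) =
      ∑ᶠ i : ℕ, (((-1 : ℤ) ^ i * Ring.choose r i : ℤ) •
        (VertexOperator.ncoeff (Y a) (p + r - i) (VertexOperator.ncoeff (Y b) (q + i) c) -
          ((-1 : ℂ) ^ r) •
            VertexOperator.ncoeff (Y b) (q + r - i) (VertexOperator.ncoeff (Y a) (p + i) c)))

namespace VertexAlgebra

variable {V : Type*} [AddCommGroup V] [Module ℂ V] (A : VertexAlgebra V)

/-- The mode `a_n`, an endomorphism of `V`. -/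
def mode (a : V) (n : ℤ) : Module.End ℂ V := VertexOperator.ncoeff (A.Y a) n

/-- The element `a⁽¹⁾_{k₁} a⁽²⁾_{k₂} ⋯ a⁽ᵐ⁾_{kₘ} v`. -/
def modeProd {m : ℕ} (a : Fin m → V) (k : Fin m → ℤ) (v : V) : V :=
  (List.ofFn fun i => A.mode (a i) (k i)).prod v

/-- A subspace that is a vertex subalgebra. -/
def IsVertexSubalgebra (U : Submodule ℂ V) : Prop :=
  A.vac ∈ U ∧ ∀ a ∈ U, ∀ b ∈ U, ∀ n : ℤ, A.mode a n b ∈ U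

/-- `⟨S⟩ᴷ`: the span of all `a⁽¹⁾_{-k₁} ⋯ a⁽ᵐ⁾_{-kₘ} 𝟏` with `a⁽ⁱ⁾ ∈ S` and `kᵢ ≥ K`. -/
def posGen (S : Set V) (K : ℤ) : Submodule ℂ V :=
  Submodule.span ℂ {w | ∃ (m : ℕ) (a : Fin m → V) (k : Fin m → ℤ),
    (∀ i, a i ∈ S) ∧ (∀ i, K ≤ k i) ∧ w = A.modeProd a (fun i => -k i) A.vac}

/-- `F_r(v)`: the span of all `a⁽¹⁾_{-k₁} ⋯ a⁽ᵐ⁾_{-kₘ} v` with `m ≤ r`, `a⁽ⁱ⁾ ∈ S` and `kᵢ ≥ K`. -/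
def filt (S : Set V) (K : ℤ) (r : ℕ) (v : V) : Submodule ℂ V :=
  Submodule.span ℂ {w | ∃ (m : ℕ) (a : Fin m → V) (k : Fin m → ℤ),
    m ≤ r ∧ (∀ i, a i ∈ S) ∧ (∀ i, K ≤ k i) ∧ w = A.modeProd a (fun i => -k i) v}

/-- The permutation property on `W` of the algebra `⟨S⟩ᴷ`: for `m ≥ 1`, reordering the factors
of a product `a⁽¹⁾_{-k₁} ⋯ a⁽ᵐ⁾_{-kₘ} v` of modes of generators changes it
by an element of `F_{m-1}(v)`. -/
def PermutationProperty (S : Set V) (K : ℤ) (W : Set V) : Prop :=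
  ∀ (m : ℕ), 1 ≤ m → ∀ (σ : Equiv.Perm (Fin m)) (a : Fin m → V) (k : Fin m → ℤ),
    (∀ i, a i ∈ S) → (∀ i, K ≤ k i) → ∀ v ∈ W,
      A.modeProd a (fun i => -k i) v -
        A.modeProd (fun i => a (σ i)) (fun i => -k (σ i)) v ∈ A.filt S K (m - 1) v

/-- `U = ⟨S⟩¹` acts strongly on `W`. -/
def ActsStrongly (S : Set V) (W : Set V) : Prop :=
  A.PermutationProperty S 1 W ∧
    ∀ a ∈ A.posGen S 1, ∀ w ∈ W, ∀ j : ℤ, 0 ≤ j → A.mode a j w = 0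

/-- The operator `u_{-N}^{i_N} u_{-N+1}^{i_{N-1}} ⋯ u_{-1}^{i_1}`; only the exponents
`i 1, …, i N` are used. -/
def ordProd (u : V) (i : ℕ → ℕ) : ℕ → Module.End ℂ V
  | 0 => 1
  | N + 1 => A.mode u (-((N : ℤ) + 1)) ^ i (N + 1) * ordProd u i N

end VertexAlgebra

/-- A vertex operator algebra: a vertex algebra with a conformal vector `ω`, whose modes
`L(m) = ω_{m+1}` satisfy the Virasoro relations with central charge `c` and the `L(-1)`-derivative
property, and such that `V` is the direct sum of the eigenspaces of `L(0)` for integral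
eigenvalues, all of them finite dimensional and zero for sufficiently negative eigenvalues. -/
structure VertexOperatorAlgebra (V : Type*) [AddCommGroup V] [Module ℂ V]
    extends VertexAlgebra V where
  /-- the conformal vector -/
  conf : V
  /-- the central charge -/
  c : ℂ
  virasoro : ∀ m n : ℤ,
    ⁅toVertexAlgebra.mode conf (m + 1), toVertexAlgebra.mode conf (n + 1)⁆ =
      ((m : ℂ) - n) • toVertexAlgebra.mode conf (m + n + 1) +
        (if m + n = 0 then ((m : ℂ) ^ 3 - m) / 12 * c else 0) • (1 : Module.End ℂ V)
  derivative : ∀ (a : V) (n : ℤ),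
    toVertexAlgebra.mode (toVertexAlgebra.mode conf 0 a) n =
      (-(n : ℂ)) • toVertexAlgebra.mode a (n - 1)
  isInternal : DirectSum.IsInternal fun k : ℤ =>
    Module.End.eigenspace (toVertexAlgebra.mode conf 1) (k : ℂ)
  finiteDimensional : ∀ k : ℤ,
    FiniteDimensional ℂ (Module.End.eigenspace (toVertexAlgebra.mode conf 1) (k : ℂ))
  bounded : ∃ N : ℤ, ∀ k < N,
    Module.End.eigenspace (toVertexAlgebra.mode conf 1) (k : ℂ) = ⊥

namespace VertexOperatorAlgebra

variable {V : Type*} [AddCommGroup V] [Module ℂ V] (A : VertexOperatorAlgebra V)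

/-- The Virasoro operator `L(m) = ω_{m+1}`. -/
def L (m : ℤ) : Module.End ℂ V := A.mode A.conf (m + 1)

/-- The space `V_(k)` of vectors of weight `k`. -/
def weightSpace (k : ℤ) : Submodule ℂ V := Module.End.eigenspace (A.mode A.conf 1) (k : ℂ)

/-- The component of weight `k` of a vector. -/
def component (k : ℤ) (v : V) : V :=
  letI := A.isInternal.chooseDecomposition
  (DirectSum.decompose
    (fun k : ℤ => Module.End.eigenspace (A.mode A.conf 1) (k : ℂ)) v k : V)

/-- `Res_x (1 + x)^s x^{-t} Y(a, x) b = ∑_{i ≥ 0} binom(s, i) a_{i - t} b`. -/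
def res (s t : ℤ) (a b : V) : V :=
  ∑ᶠ i : ℕ, (Ring.choose s i : ℤ) • A.mode a ((i : ℤ) - t) b

/-- `O^L(V)`. -/
def OL : Submodule ℂ V := LinearMap.range (A.L (-1) + A.L 0)

/-- `O_n^∘(V)`, spanned by the circle products `a ∘_n b` with `a` homogeneous. -/
def Ocirc (n : ℕ) : Submodule ℂ V :=
  Submodule.span ℂ {w | ∃ (d : ℤ) (a b : V), a ∈ A.weightSpace d ∧
    w = A.res (d + n) (2 * n + 2) a b}

/-- `O_n(V)`. -/
def O (n : ℕ) : Submodule ℂ V := A.OL ⊔ A.Ocirc n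

/-- The product `a *_n b`, for all `a` by linearity in `a`. -/
def star (n : ℕ) (a b : V) : V :=
  ∑ᶠ d : ℤ, ∑ m ∈ Finset.range (n + 1),
    ((-1 : ℤ) ^ m * ((m + n).choose n : ℤ)) • A.res (d + n) (n + m + 1) (A.component d a) b

/-- `A_n(V) = V / O_n(V)`. -/
abbrev Zhu (n : ℕ) : Type _ := V ⧸ A.O n

/-- The class `v + O_n(V)` in `A_n(V)`. -/
def cls (n : ℕ) (v : V) : A.Zhu n := (A.O n).mkQ v

/-- A subalgebra of `A_n(V)`: a subspace that contains the unit `𝟏 + O_n(V)` and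
is closed under the product induced by `*_n`. -/
def IsZhuSubalgebra (n : ℕ) (B : Submodule ℂ (A.Zhu n)) : Prop :=
  A.cls n A.vac ∈ B ∧
    ∀ a b : V, A.cls n a ∈ B → A.cls n b ∈ B → A.cls n (A.star n a b) ∈ B

/-- The subalgebra of `A_n(V)` generated by a set. -/
def zhuAdjoin (n : ℕ) (X : Set (A.Zhu n)) : Submodule ℂ (A.Zhu n) :=
  sInf {B | A.IsZhuSubalgebra n B ∧ X ⊆ B}

/-- `V^u = ⟨u⟩¹`. -/
def Vu (u : V) : Submodule ℂ V := A.posGen {u} 1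

/-- `A_n^u`: the subalgebra of `A_n(V)` generated by the elements of `V^u`. -/
def Anu (n : ℕ) (u : V) : Submodule ℂ (A.Zhu n) :=
  A.zhuAdjoin n (A.cls n '' (A.Vu u : Set V))

/-- `A_n^u . W`: the elements `u_{-k₁} ⋯ u_{-kₘ} v + O_n(V)` of `A_n(V)` with `v ∈ W`
and all `kⱼ ≥ 1`. -/
def AnuAct (n : ℕ) (u : V) (W : Set V) : Set (A.Zhu n) :=
  {x | ∃ v ∈ W, ∃ (m : ℕ) (k : Fin m → ℤ), (∀ j, 1 ≤ k j) ∧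
    x = A.cls n (A.modeProd (fun _ => u) (fun j => -k j) v)}

end VertexOperatorAlgebra

end

/-! If `u_j v = 0` for all `j ≥ 0`, every mode of `u` commutes with every mode of `v`. A monomial in
the `u_{-j}` applied to `v_{-k} 𝟏` is therefore `v_{-k}` applied to the same monomial on the vacuum,
and all reductions can be made inside `V^u`, under a fixed outer operator. The choice `v = 𝟏`, `k =
1` gives the statement about `A_n^u`.

Two relations drive the reductions. Integration by parts puts `Res_x (1+x)^{wt u+n} x^{-2n-2-m}
Y(u,x)b` in `O_n(V)` for every `m ≥ 0`. Since `wt u + n ≥ 0`, this residue is a finite sum, and it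
trades `u_{-2n-2-m}` for modes that raise the weight less (`mode_add_sum_mem_O`). The relation
`(L(-1)+L(0)) v_{-k} b ∈ O^L(V)` expresses `v_{-k} L(-1)b` through `v_{-k-1} b` and `v_{-k} b`,
where `b` has smaller weight than `L(-1)b` (`mode_conf_zero_mem`). As `L(-1)` is a derivation that
kills the vacuum, `L(-1)b` is, up to reordering, the sum over all ways to raise one index of a
monomial `b` (`conf_zero_monoOp_vac`). With `b = u_{-2n} ⋯ 𝟏` this eliminates a factor `u_{-2n-1}`.

The spanning statements follow by induction on the weight of the `V^u` part, then on the length of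
the monomial, then on the number of factors `u_{-2n-1}`. The weights are bounded below, so the
induction starts. The explicit formulas come from the same relations with the coefficients recorded.
Reordering errors lie in `err`, which is zero when the `u_{-j}` commute, so one computation gives
both the filtration bound on `f` and the case `f = 0`. -/

namespace VertexAlgebra

variable {V : Type*} [AddCommGroup V] [Module ℂ V] (A : VertexAlgebra V)

/-! ### Commutators of modes. -/

/-- The commutator formula for modes. -/
theorem mode_commutator (a b c : V) (p q : ℤ) :
    A.mode a p (A.mode b q c) - A.mode b q (A.mode a p c) =
      ∑ᶠ i : ℕ, (Ring.choose p i : ℤ) • A.mode (A.mode a i b) (p + q - i) c := by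
  have h := A.jacobi a b c p q 0
  rw [finsum_eq_single (fun i : ℕ => (((-1 : ℤ) ^ i * Ring.choose (0 : ℤ) i : ℤ) •
        (VertexOperator.ncoeff (A.Y a) (p + 0 - i) (VertexOperator.ncoeff (A.Y b) (q + i) c) -
          ((-1 : ℂ) ^ (0 : ℤ)) •
            VertexOperator.ncoeff (A.Y b) (q + 0 - i)
              (VertexOperator.ncoeff (A.Y a) (p + i) c)))) 0] at h
  · simpa [mode] using h.symm
  · intro i hi
    simp [Ring.choose_zero_pos ℤ (Nat.pos_of_ne_zero hi)]

/-- The commutator formula involves only the products `a_j b` with `j ≥ 0`. This is what lets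
`v_{-k}` be moved past all modes of `u`. -/
theorem mode_commute_of_nonneg_eq_zero {a b : V} (h : ∀ j : ℤ, 0 ≤ j → A.mode a j b = 0)
    (p q : ℤ) (c : V) : A.mode a p (A.mode b q c) = A.mode b q (A.mode a p c) := by
  rw [← sub_eq_zero, mode_commutator]
  refine (finsum_congr fun i => ?_).trans finsum_zero
  rw [h i (by positivity)]
  simp [mode]

theorem mode_zero_commutator (a b c : V) (q : ℤ) :
    A.mode a 0 (A.mode b q c) - A.mode b q (A.mode a 0 c) = A.mode (A.mode a 0 b) q c := by
  rw [mode_commutator, finsum_eq_single _ 0]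
  · simp
  · intro i hi
    simp [Ring.choose_zero_pos ℤ (Nat.pos_of_ne_zero hi)]

theorem mode_one_commutator (a b c : V) (q : ℤ) :
    A.mode a 1 (A.mode b q c) - A.mode b q (A.mode a 1 c) =
      A.mode (A.mode a 0 b) (1 + q) c + A.mode (A.mode a 1 b) q c := by
  rw [mode_commutator, finsum_eq_sum_of_support_subset (s := Finset.range 2)]
  · simp [Finset.sum_range_succ]
  · intro i hi
    by_contra hlt
    simp only [Finset.coe_range, Set.mem_Iio, not_lt] at hlt
    apply hi
    have : Ring.choose (1 : ℤ) i = 0 := by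
      have := Ring.choose_natCast (R := ℤ) 1 i
      rw [Nat.cast_one] at this
      rw [this, Nat.choose_eq_zero_of_lt (by omega), Nat.cast_zero]
    simp [this]

theorem mode_vac_apply (m : ℤ) (b : V) : A.mode A.vac m b = if m = -1 then b else 0 :=
  A.vac_mode m b

/-! ### Monomials in the modes of `u` as lists (the entry `k` stands for `u_{-k-1}`), and their
reordering. -/

/-- The operator `u_{-k₁-1} ⋯ u_{-kₘ-1}` attached to the list `k₁, …, kₘ`. -/
def monoOp (u : V) (l : List ℕ) : Module.End ℂ V :=
  (l.map fun k : ℕ => A.mode u (-((k : ℤ) + 1))).prod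

/-- The span of the vectors `u_{-k₁-1} ⋯ u_{-kₘ-1} v` with `m < r`. -/
def lower (u : V) (r : ℕ) (v : V) : Submodule ℂ V :=
  Submodule.span ℂ {w | ∃ l : List ℕ, l.length < r ∧ w = A.monoOp u l v}

@[simp] theorem monoOp_nil (u : V) : A.monoOp u [] = 1 := rfl

@[simp] theorem monoOp_cons (u : V) (k : ℕ) (l : List ℕ) :
    A.monoOp u (k :: l) = A.mode u (-((k : ℤ) + 1)) * A.monoOp u l := by
  simp [monoOp]

theorem monoOp_append (u : V) (l l' : List ℕ) :
    A.monoOp u (l ++ l') = A.monoOp u l * A.monoOp u l' := by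
  simp [monoOp]

theorem modeProd_eq_monoOp {u : V} {m : ℕ} {a : Fin m → V} {k : Fin m → ℤ}
    (ha : ∀ i, a i = u) (hk : ∀ i, 1 ≤ k i) (v : V) :
    A.modeProd a (fun i => -k i) v =
      A.monoOp u (List.ofFn fun i => (k i - 1).toNat) v := by
  unfold modeProd monoOp
  rw [List.map_ofFn]
  congr 4
  funext i
  have := hk i
  simp only [Function.comp, ha]
  congr 1
  omega

theorem monoOp_eq_modeProd (u : V) (l : List ℕ) (v : V) :
    A.monoOp u l v =
      A.modeProd (fun _ : Fin l.length => u) (fun i => -((l.get i : ℤ) + 1)) v := by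
  unfold modeProd monoOp
  congr 2
  conv_lhs => rw [← List.ofFn_get l, List.map_ofFn]
  rfl

/-- The strict bound in `lower` absorbs the shift: `F_{r-1}` is `lower u r`, and `r = 0` gives the
zero space. -/
theorem filt_singleton (u : V) (r : ℕ) (v : V) :
    A.filt {u} 1 r v = A.lower u (r + 1) v := by
  unfold filt lower
  congr 1
  ext w
  constructor
  · rintro ⟨m, a, k, hm, ha, hk, rfl⟩
    exact ⟨List.ofFn fun i => (k i - 1).toNat, by simpa using Nat.lt_succ_of_le hm,
      A.modeProd_eq_monoOp ha hk v⟩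
  · rintro ⟨l, hl, rfl⟩
    exact ⟨l.length, _, _, Nat.le_of_lt_succ hl, fun _ => rfl, fun i => by omega,
      A.monoOp_eq_modeProd u l v⟩

theorem posGen_singleton (u : V) :
    A.posGen {u} 1 = Submodule.span ℂ (Set.range fun l => A.monoOp u l A.vac) := by
  unfold posGen
  congr 1
  ext w
  constructor
  · rintro ⟨m, a, k, ha, hk, rfl⟩
    exact ⟨_, (A.modeProd_eq_monoOp ha hk _).symm⟩
  · rintro ⟨l, rfl⟩
    exact ⟨l.length, _, _, fun _ => rfl, fun i => by omega, A.monoOp_eq_modeProd u l _⟩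

theorem monoOp_vac_mem (u : V) (l : List ℕ) : A.monoOp u l A.vac ∈ A.posGen {u} 1 := by
  rw [posGen_singleton]
  exact Submodule.subset_span ⟨l, rfl⟩

theorem self_mem_posGen (u : V) : u ∈ A.posGen {u} 1 := by
  have h := A.monoOp_vac_mem u [0]
  have h2 : A.monoOp u [0] A.vac = u := by
    simpa [mode] using A.mode_vac_neg_one u
  rwa [h2] at h

theorem vac_mem_posGen (u : V) : A.vac ∈ A.posGen {u} 1 := by
  simpa using A.monoOp_vac_mem u []

theorem mode_mem_lower {u v w : V} {r : ℕ} (k : ℕ) (hw : w ∈ A.lower u r v) :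
    A.mode u (-((k : ℤ) + 1)) w ∈ A.lower u (r + 1) v := by
  have : A.lower u r v ≤ (A.lower u (r + 1) v).comap (A.mode u (-((k : ℤ) + 1))) := by
    refine Submodule.span_le.2 ?_
    rintro _ ⟨l, hl, rfl⟩
    exact Submodule.subset_span ⟨k :: l, by simpa using hl, by simp⟩
  exact this hw

/-- The fibres of `f` and `g` over each value have equal size, so bijections of fibres glue to a
permutation of the indices. This translates `List.Perm` into the form used by `PermutationProperty`.
-/
theorem exists_perm_of_ofFn_perm {α : Type*} {m : ℕ} {f g : Fin m → α}
    (h : (List.ofFn f).Perm (List.ofFn g)) : ∃ σ : Equiv.Perm (Fin m), g = f ∘ σ := by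
  classical
  rw [← Multiset.coe_eq_coe, ← Fin.univ_val_map, ← Fin.univ_val_map] at h
  have hcard : ∀ x, Fintype.card {i // g i = x} = Fintype.card {i // f i = x} := by
    intro x
    have := congrArg (Multiset.count x) h
    simp only [Multiset.count_map, eq_comm (a := x)] at this
    rw [Fintype.card_subtype, Fintype.card_subtype]
    exact this.symm
  refine ⟨Equiv.ofFiberEquiv fun x => Fintype.equivOfCardEq (hcard x), ?_⟩
  funext i
  exact (Equiv.ofFiberEquiv_map _ i).symm

theorem monoOp_sub_mem_lower {u : V} {X : Set V} (h : A.PermutationProperty {u} 1 X) {v : V}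
    (hv : v ∈ X) {l l' : List ℕ} (hl : l.Perm l') :
    A.monoOp u l v - A.monoOp u l' v ∈ A.lower u l.length v := by
  rcases Nat.eq_zero_or_pos l.length with h0 | h0
  · obtain rfl := List.length_eq_zero_iff.1 h0
    obtain rfl := hl.nil_eq
    simp
  obtain ⟨σ, hσ⟩ := exists_perm_of_ofFn_perm (f := l.get)
    (g := fun i => l'.get (i.cast hl.length_eq)) (by
      rw [List.ofFn_get]
      convert hl
      apply List.ext_get <;> simp [hl.length_eq])
  have key := h l.length h0 σ (fun _ => u) (fun i => (l.get i : ℤ) + 1) (fun _ => rfl)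
    (fun i => by omega) v hv
  rw [filt_singleton, Nat.sub_add_cancel h0, ← monoOp_eq_modeProd] at key
  convert key using 2
  rw [monoOp_eq_modeProd]
  have h2 : ∀ i, l'.get (i.cast hl.length_eq) = l.get (σ i) := fun i => congrFun hσ i
  simp only [← h2]
  unfold modeProd
  congr 2
  apply List.ext_get <;> simp [hl.length_eq]

open Classical in
/-- The error space: `lower u r v`, or zero if the modes `u_{-j}`, `j ≥ 1`, commute. -/
noncomputable def err (u : V) (r : ℕ) (v : V) : Submodule ℂ V :=
  if ∀ p q : ℤ, 1 ≤ p → 1 ≤ q → Commute (A.mode u (-p)) (A.mode u (-q)) then ⊥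
  else A.lower u r v

theorem err_le_lower (u : V) (r : ℕ) (v : V) : A.err u r v ≤ A.lower u r v := by
  unfold err
  split_ifs <;> simp

theorem eq_zero_of_mem_err {u : V} {r : ℕ} {v w : V} (hw : w ∈ A.err u r v)
    (h : ∀ p q : ℤ, 1 ≤ p → 1 ≤ q → Commute (A.mode u (-p)) (A.mode u (-q))) : w = 0 := by
  simpa [err, if_pos h] using hw

theorem mode_mem_err {u v w : V} {r : ℕ} (k : ℕ) (hw : w ∈ A.err u r v) :
    A.mode u (-((k : ℤ) + 1)) w ∈ A.err u (r + 1) v := by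
  unfold err at *
  split_ifs at hw with h
  · simp_all
  · simpa only [if_neg h] using A.mode_mem_lower k hw

theorem monoOp_sub_mem_err {u : V} {X : Set V} (h : A.PermutationProperty {u} 1 X) {v : V}
    (hv : v ∈ X) {l l' : List ℕ} (hl : l.Perm l') :
    A.monoOp u l v - A.monoOp u l' v ∈ A.err u l.length v := by
  unfold err
  split_ifs with hc
  · rw [Submodule.mem_bot, sub_eq_zero]
    congr 1
    refine (hl.map _).prod_eq' ?_
    refine List.pairwise_of_forall_mem_list ?_
    simp only [List.mem_map]
    rintro _ ⟨k, -, rfl⟩ _ ⟨k', -, rfl⟩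
    exact hc _ _ (by omega) (by omega)
  · exact A.monoOp_sub_mem_lower h hv hl

/-- The list of the ordered monomial `u_{-N}^{i_N} ⋯ u_{-1}^{i_1}`. -/
def ordList (i : ℕ → ℕ) : ℕ → List ℕ
  | 0 => []
  | N + 1 => List.replicate (i (N + 1)) N ++ ordList i N

theorem ordProd_eq_monoOp (u : V) (i : ℕ → ℕ) (N : ℕ) :
    A.ordProd u i N = A.monoOp u (ordList i N) := by
  induction N with
  | zero => rfl
  | succ N ih =>
    rw [ordProd, ordList, monoOp_append, ih]
    simp [monoOp]

theorem count_ordList (i : ℕ → ℕ) (N j : ℕ) :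
    (ordList i N).count j = if j < N then i (j + 1) else 0 := by
  induction N with
  | zero => simp [ordList]
  | succ N ih =>
    rw [ordList, List.count_append, ih, List.count_replicate]
    simp only [beq_iff_eq]
    grind

theorem length_ordList (i : ℕ → ℕ) (N : ℕ) :
    (ordList i N).length = ∑ j ∈ Finset.Icc 1 N, i j := by
  induction N with
  | zero => simp [ordList]
  | succ N ih => simp [ordList, ih, Finset.sum_Icc_succ_top, add_comm]

theorem perm_ordList_of_lt {l : List ℕ} {N : ℕ} (h : ∀ k ∈ l, k < N) :
    l.Perm (ordList (fun j => l.count (j - 1)) N) := by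
  rw [List.perm_iff_count]
  intro j
  rw [count_ordList]
  split_ifs with hj
  · simp
  · exact List.count_eq_zero.2 fun hl => hj (h j hl)

end VertexAlgebra

/-! ### Weights, `L(-1)`, and the relations modulo `O_n(V)`. -/

namespace VertexOperatorAlgebra

variable {V : Type*} [AddCommGroup V] [Module ℂ V] (A : VertexOperatorAlgebra V)

theorem add_mem_OL (x : V) : A.mode A.conf 0 x + A.mode A.conf 1 x ∈ A.OL := ⟨x, rfl⟩

theorem conf_zero_mode (a c : V) (q : ℤ) :
    A.mode A.conf 0 (A.mode a q c) =
      A.mode a q (A.mode A.conf 0 c) + (-(q : ℂ)) • A.mode a (q - 1) c := by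
  rw [← sub_eq_iff_eq_add', A.mode_zero_commutator, A.derivative]
  rfl

theorem conf_zero_vac : A.mode A.conf 0 A.vac = 0 := A.mode_vac_nonneg _ _ le_rfl

theorem mem_weightSpace {e : ℤ} {v : V} :
    v ∈ A.weightSpace e ↔ A.mode A.conf 1 v = (e : ℂ) • v := Module.End.mem_eigenspace_iff

theorem vac_mem_weightSpace : A.vac ∈ A.weightSpace 0 := by
  rw [mem_weightSpace]
  rw [Int.cast_zero, zero_smul]
  exact A.mode_vac_nonneg _ 1 zero_le_one

theorem mode_mem_weightSpace {a c : V} {d e f : ℤ} (ha : a ∈ A.weightSpace d)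
    (hc : c ∈ A.weightSpace e) (q : ℤ) (hf : f = d + e - q - 1) :
    A.mode a q c ∈ A.weightSpace f := by
  rw [mem_weightSpace] at *
  have h := A.mode_one_commutator A.conf a c q
  rw [sub_eq_iff_eq_add', A.derivative, ha, hc] at h
  have h2 : A.mode ((d : ℂ) • a) q c = (d : ℂ) • A.mode a q c := by simp [VertexAlgebra.mode]
  rw [h, h2, hf]
  simp only [add_sub_cancel_left, map_smul, LinearMap.smul_apply]
  push_cast
  module

theorem conf_zero_mem_weightSpace {a : V} {d : ℤ} (ha : a ∈ A.weightSpace d) :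
    A.mode A.conf 0 a ∈ A.weightSpace (d + 1) := by
  rw [mem_weightSpace] at *
  have h := LinearMap.congr_fun (A.virasoro 0 (-1)) a
  rw [Ring.lie_def] at h
  simp only [zero_add, neg_add_cancel, LinearMap.sub_apply, Module.End.mul_apply, ha] at h
  rw [sub_eq_iff_eq_add] at h
  rw [h]
  simp only [map_smul, LinearMap.add_apply, LinearMap.smul_apply]
  norm_num
  module

theorem monoOp_mem_weightSpace {u v : V} {d e : ℤ} (hu : u ∈ A.weightSpace d)
    (hv : v ∈ A.weightSpace e) (l : List ℕ) :
    A.monoOp u l v ∈ A.weightSpace ((l.map fun k : ℕ => d + k).sum + e) := by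
  induction l with
  | nil => simpa using hv
  | cons k l ih =>
    rw [A.monoOp_cons]
    exact A.mode_mem_weightSpace hu ih _ (by simp; ring)

/-- A homogeneous vector in the span of a set of homogeneous vectors lies in the span of
those of the same weight. -/
theorem mem_span_inter_weightSpace {S : Set V} (hS : ∀ x ∈ S, ∃ e, x ∈ A.weightSpace e)
    {x : V} {w : ℤ} (hx : x ∈ Submodule.span ℂ S) (hw : x ∈ A.weightSpace w) :
    x ∈ Submodule.span ℂ (S ∩ A.weightSpace w) := by
  -- Projection to weight `w` maps each element of `S` to itself or to zero, and fixes `x`.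
  let _ := A.isInternal.chooseDecomposition
  have key : ∀ y ∈ Submodule.span ℂ S,
      (DirectSum.decompose (fun k : ℤ => Module.End.eigenspace (A.mode A.conf 1) (k : ℂ)) y w : V)
        ∈ Submodule.span ℂ (S ∩ A.weightSpace w) := by
    intro y hy
    induction hy using Submodule.span_induction with
    | mem y hy =>
      obtain ⟨e, he⟩ := hS y hy
      by_cases h : e = w
      · subst h
        rw [DirectSum.decompose_of_mem_same
          (fun k : ℤ => Module.End.eigenspace (A.mode A.conf 1) (k : ℂ)) he]
        exact Submodule.subset_span ⟨hy, he⟩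
      · rw [DirectSum.decompose_of_mem_ne
          (fun k : ℤ => Module.End.eigenspace (A.mode A.conf 1) (k : ℂ)) he h]
        exact zero_mem _
    | zero => simp
    | add y z _ _ hy hz =>
      rw [DirectSum.decompose_add]
      exact add_mem hy hz
    | smul c y _ hy =>
      rw [DirectSum.decompose_smul]
      exact Submodule.smul_mem _ c hy
  have := key x hx
  rwa [DirectSum.decompose_of_mem_same
          (fun k : ℤ => Module.End.eigenspace (A.mode A.conf 1) (k : ℂ)) hw] at this

/-- `Res_x (1 + x)^S x^{-t} Y(a, x) b` for a natural number `S`. -/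
def natRes (S : ℕ) (t : ℤ) (a b : V) : V :=
  ∑ i ∈ Finset.range (S + 1), ((S.choose i : ℕ) : ℂ) • A.mode a ((i : ℤ) - t) b

theorem res_natCast (S : ℕ) (t : ℤ) (a b : V) : A.res S t a b = A.natRes S t a b := by
  unfold res natRes
  rw [finsum_eq_sum_of_support_subset (s := Finset.range (S + 1))]
  · refine Finset.sum_congr rfl fun i _ => ?_
    rw [Ring.choose_natCast, Nat.cast_smul_eq_nsmul, Nat.cast_smul_eq_nsmul]
  · intro i hi
    by_contra hlt
    simp only [Finset.coe_range, Set.mem_Iio, not_lt] at hlt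
    apply hi
    simp only []
    rw [Ring.choose_natCast, Nat.choose_eq_zero_of_lt (by omega), Nat.cast_zero, zero_smul]

/-- Integration by parts, since `Y(L(-1)a, x)` is the derivative of `Y(a, x)`: the derivative of
`(1+x)^{S+1} x^{-t}` is `-(1+x)^S (t x^{-t-1} + (t-S-1) x^{-t})`. The proof compares coefficients.
-/
theorem natRes_conf_zero (S : ℕ) (t : ℤ) (a b : V) :
    A.natRes (S + 1) t (A.mode A.conf 0 a) b =
      (t : ℂ) • A.natRes S (t + 1) a b + ((t : ℂ) - S - 1) • A.natRes S t a b := by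
  have hL : A.natRes (S + 1) t (A.mode A.conf 0 a) b =
      ∑ i ∈ Finset.range (S + 2), (((S + 1).choose i : ℂ) * (t - i)) •
        A.mode a ((i : ℤ) - (t + 1)) b := by
    unfold natRes
    refine Finset.sum_congr rfl fun i _ => ?_
    rw [A.derivative, LinearMap.smul_apply, smul_smul, sub_sub]
    push_cast
    congr 2
    ring
  have h1 : A.natRes S (t + 1) a b = ∑ i ∈ Finset.range (S + 2), (S.choose i : ℂ) •
        A.mode a ((i : ℤ) - (t + 1)) b := by
    rw [Finset.sum_range_succ, Nat.choose_succ_self]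
    simp [natRes]
  rw [hL, h1, Finset.sum_range_succ', Finset.sum_range_succ' _ (S + 1), smul_add, natRes,
    Finset.smul_sum, Finset.smul_sum, add_right_comm, ← Finset.sum_add_distrib]
  congr 1
  · refine Finset.sum_congr rfl fun i _ => ?_
    have e : ((i + 1 : ℕ) : ℤ) - (t + 1) = i - t := by push_cast; ring
    rw [e, smul_smul, smul_smul, ← add_smul]
    congr 1
    have h := Nat.add_one_mul_choose_eq S i
    have h' : ((S : ℂ) + 1) * S.choose i = (S + 1).choose (i + 1) * (i + 1) := by
      exact_mod_cast h
    have h2 : ((S + 1).choose (i + 1) : ℂ) = S.choose i + S.choose (i + 1) := by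
      exact_mod_cast Nat.choose_succ_succ S i
    push_cast
    rw [mul_sub, ← h', h2]
    ring
  · simp

/-- The case `m` for `L(-1)a`, of weight `d + 1`, and for `a` leaves `2n+2+m` times the case `m + 1`
for `a`, and this factor is nonzero. The induction therefore has to range over all `a` and `S`. -/
theorem natRes_mem_O {n : ℕ} (m : ℕ) : ∀ {S : ℕ} {a b : V} {d : ℤ}, a ∈ A.weightSpace d →
    d + n = S → A.natRes S (2 * n + 2 + m) a b ∈ A.O n := by
  induction m with
  | zero =>
    intro S a b d ha hS
    refine Submodule.mem_sup_right (Submodule.subset_span ⟨d, a, b, ha, ?_⟩)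
    rw [hS, res_natCast]
    simp
  | succ m ih =>
    intro S a b d ha hS
    have h1 := ih (b := b) (A.conf_zero_mem_weightSpace ha)
      (show d + 1 + n = ((S + 1 : ℕ) : ℤ) by push_cast; omega)
    have h2 := ih (b := b) ha hS
    rw [natRes_conf_zero, Submodule.add_mem_iff_left _ (Submodule.smul_mem _ _ h2),
      Submodule.smul_mem_iff] at h1
    · convert h1 using 2
      push_cast
      ring
    · have : (2 * (n : ℂ) + 2 + m) = ((2 * n + 2 + m : ℕ) : ℂ) := by push_cast; ring
      push_cast
      rw [this, Nat.cast_ne_zero]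
      omega

/-- The reduction of the modes `u_{-K}`, `K ≥ 2n + 2`, modulo `O_n(V)`. -/
theorem mode_add_sum_mem_O {n S : ℕ} (m : ℕ) {u : V} {d : ℤ} (hu : u ∈ A.weightSpace d)
    (hS : d + n = S) (b : V) :
    A.mode u (-(2 * (n : ℤ) + 2 + m)) b + ∑ i ∈ Finset.range S,
      ((S.choose (i + 1) : ℕ) : ℂ) • A.mode u ((i : ℤ) + 1 - (2 * n + 2 + m)) b ∈ A.O n := by
  have h := A.natRes_mem_O (n := n) m (b := b) hu hS
  rw [natRes, Finset.sum_range_succ', add_comm] at h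
  simpa using h

/-- The action of `L(-1)` on the monomials of `V^u`, up to terms of lower length. -/
theorem conf_zero_monoOp_vac {u : V} (hperm : A.PermutationProperty {u} 1 (A.Vu u)) {N : ℕ}
    (l : List ℕ) (hl : ∀ k ∈ l, k < N) :
    A.mode A.conf 0 (A.monoOp u l A.vac) - ∑ j ∈ Finset.range N,
      (((j : ℂ) + 1) * (l.count j : ℕ)) • A.monoOp u ((j + 1) :: l.erase j) A.vac ∈
        A.err u l.length A.vac := by
  induction l with
  | nil => simp [conf_zero_vac]
  | cons k l ih =>
    have ih := A.mode_mem_err k (ih fun k hk => hl k (List.mem_cons_of_mem _ hk))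
    have hk : k < N := hl k List.mem_cons_self
    -- Moving the raised factor `j + 1` past the new head `k` is one reordering. If `j ∉ l`, the
    -- coefficient is zero and the value of `l.erase j` is irrelevant.
    have key : ∀ j : ℕ, (((j : ℂ) + 1) * (l.count j : ℕ)) •
        (A.monoOp u ((j + 1) :: (k :: l).erase j) A.vac -
          A.mode u (-((k : ℤ) + 1)) (A.monoOp u ((j + 1) :: l.erase j) A.vac)) ∈
        A.err u (k :: l).length A.vac := by
      intro j
      by_cases hj : j ∈ l
      · refine Submodule.smul_mem _ _ ?_
        have hp : ((j + 1) :: (k :: l).erase j).Perm (k :: (j + 1) :: l.erase j) := by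
          rw [List.perm_iff_count]
          intro x
          have := List.count_pos_iff.2 hj
          simp only [List.count_cons, List.count_erase, beq_iff_eq]
          grind
        have h := A.monoOp_sub_mem_err hperm (A.vac_mem_posGen u) hp
        have hlen : ((j + 1) :: (k :: l).erase j).length = (k :: l).length := by
          rw [List.length_cons, List.length_erase_of_mem (List.mem_cons_of_mem _ hj)]
          simp
        rw [hlen, A.monoOp_cons u k] at h
        exact h
      · simp [List.count_eq_zero.2 hj]
    have hsum := Submodule.sum_mem _ fun j (_ : j ∈ Finset.range N) => key j
    rw [List.length_cons] at *
    convert sub_mem ih hsum using 1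
    have hcount : ∀ j, (((k :: l).count j : ℕ) : ℂ) = l.count j + if j = k then 1 else 0 := by
      intro j
      rw [List.count_cons]
      simp only [beq_iff_eq, eq_comm (a := j)]
      push_cast
      rfl
    -- The extra count at `j = k` accounts for `L(-1)` hitting the head: `[L(-1), u_{-k-1}] = (k+1)
    -- u_{-k-2}`.
    have hsplit : ∀ j : ℕ, (((j : ℂ) + 1) * ((k :: l).count j : ℕ)) •
        A.monoOp u ((j + 1) :: (k :: l).erase j) A.vac =
          (((j : ℂ) + 1) * (l.count j : ℕ)) • A.monoOp u ((j + 1) :: (k :: l).erase j) A.vac +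
          if j = k then ((j : ℂ) + 1) • A.monoOp u ((j + 1) :: (k :: l).erase j) A.vac
          else 0 := by
      intro j
      rw [hcount, mul_add, add_smul]
      split_ifs <;> simp
    simp only [hsplit, Finset.sum_add_distrib]
    rw [Finset.sum_ite_eq', if_pos (Finset.mem_range.2 hk)]
    simp only [smul_sub, Finset.sum_sub_distrib, map_sub, map_sum, map_smul,
      List.erase_cons_head]
    rw [A.monoOp_cons u k l, Module.End.mul_apply, conf_zero_mode, A.monoOp_cons u (k + 1)]
    have e : -((k : ℤ) + 1) - 1 = -(((k + 1 : ℕ) : ℤ) + 1) := by push_cast; ring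
    rw [e]
    push_cast
    rw [Module.End.mul_apply]
    module

end VertexOperatorAlgebra

/-! ### Spanning by ordered monomials in `u_{-1}, …, u_{-2n}`. -/

namespace VertexOperatorAlgebra

variable {V : Type*} [AddCommGroup V] [Module ℂ V] (A : VertexOperatorAlgebra V)

theorem monoOp_mode_comm {u v : V} (hv : ∀ j : ℤ, 0 ≤ j → A.mode u j v = 0) (l : List ℕ) (q : ℤ)
    (c : V) : A.monoOp u l (A.mode v q c) = A.mode v q (A.monoOp u l c) := by
  induction l with
  | nil => simp
  | cons k l ih =>
    rw [A.monoOp_cons, Module.End.mul_apply, Module.End.mul_apply, ih,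
      A.mode_commute_of_nonneg_eq_zero hv]

theorem eq_zero_of_mem_weightSpace_of_ne {v : V} {d e : ℤ} (hd : v ∈ A.weightSpace d)
    (he : v ∈ A.weightSpace e) (h : d ≠ e) : v = 0 := by
  rw [mem_weightSpace] at hd he
  rw [hd, ← sub_eq_zero, ← sub_smul, smul_eq_zero, sub_eq_zero] at he
  exact he.resolve_left (by exact_mod_cast h)

/-- The weight of `u_{-k₁-1} ⋯ u_{-kₘ-1} 𝟏`, for `u` of weight `d`. -/
def listWeight (d : ℤ) (l : List ℕ) : ℤ := (l.map fun k : ℕ => d + k).sum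

@[simp] theorem listWeight_cons (d : ℤ) (k : ℕ) (l : List ℕ) :
    listWeight d (k :: l) = d + k + listWeight d l := by simp [listWeight]

theorem listWeight_perm (d : ℤ) {l l' : List ℕ} (h : l.Perm l') :
    listWeight d l = listWeight d l' := (h.map _).sum_eq

theorem listWeight_cons_erase (d : ℤ) {l : List ℕ} {j : ℕ} (h : j ∈ l) :
    listWeight d ((j + 1) :: l.erase j) = listWeight d l + 1 := by
  have := listWeight_perm d (List.perm_cons_erase h)
  rw [listWeight_cons] at *
  push_cast
  omega

theorem listWeight_ordList (d : ℤ) (i : ℕ → ℕ) (N : ℕ) :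
    listWeight d (VertexAlgebra.ordList i N) =
      ∑ j ∈ Finset.Icc 1 N, (i j : ℤ) * (d + j - 1) := by
  induction N with
  | zero => simp [VertexAlgebra.ordList, listWeight]
  | succ N ih =>
    rw [Finset.sum_Icc_succ_top (by omega), ← ih]
    simp [VertexAlgebra.ordList, listWeight]
    ring

theorem monoOp_vac_mem_weightSpace {u : V} {d : ℤ} (hu : u ∈ A.weightSpace d) (l : List ℕ) :
    A.monoOp u l A.vac ∈ A.weightSpace (listWeight d l) := by
  simpa [listWeight] using A.monoOp_mem_weightSpace hu A.vac_mem_weightSpace l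

theorem apply_mem_of_mem_span_monoOp {u : V} {d w : ℤ} (hu : u ∈ A.weightSpace d)
    {P : List ℕ → Prop} {f : V}
    (hf : f ∈ Submodule.span ℂ {x | ∃ l, P l ∧ x = A.monoOp u l A.vac})
    (hw : f ∈ A.weightSpace w) {T : Submodule ℂ V} {φ : Module.End ℂ V}
    (h : ∀ l, P l → listWeight d l = w → φ (A.monoOp u l A.vac) ∈ T) : φ f ∈ T := by
  have hf' := A.mem_span_inter_weightSpace
    (by rintro _ ⟨l, -, rfl⟩; exact ⟨_, A.monoOp_vac_mem_weightSpace hu l⟩) hf hw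
  refine (Submodule.span_le (p := T.comap φ)).2 ?_ hf'
  rintro _ ⟨⟨l, hl, rfl⟩, hlw⟩
  -- A monomial that lies in weight `w` but has another nominal weight is zero.
  by_cases hd : listWeight d l = w
  · exact h l hl hd
  · rw [A.eq_zero_of_mem_weightSpace_of_ne (A.monoOp_vac_mem_weightSpace hu l) hlw hd]
    exact zero_mem _

/-- The error has smaller length, but the induction fixes the weight first; homogeneity lets it be
expanded in monomials of that same weight. -/
theorem conf_zero_error_mem_weightSpace {u : V} {d : ℤ} (hu : u ∈ A.weightSpace d) {N : ℕ}
    (l : List ℕ) :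
    A.mode A.conf 0 (A.monoOp u l A.vac) - ∑ j ∈ Finset.range N,
      (((j : ℂ) + 1) * (l.count j : ℕ)) • A.monoOp u ((j + 1) :: l.erase j) A.vac ∈
        A.weightSpace (listWeight d l + 1) := by
  refine sub_mem (A.conf_zero_mem_weightSpace (A.monoOp_vac_mem_weightSpace hu l))
    (Submodule.sum_mem _ fun j _ => ?_)
  by_cases hj : j ∈ l
  · rw [← listWeight_cons_erase d hj]
    exact Submodule.smul_mem _ _ (A.monoOp_vac_mem_weightSpace hu _)
  · simp [List.count_eq_zero.2 hj]

/-- The action of `L(-1) + L(0)` on a product `v_{-k} b`. -/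
theorem mode_conf_zero_mem {v b : V} {e w : ℤ} (hv : v ∈ A.weightSpace e)
    (hb : b ∈ A.weightSpace w) (k : ℕ) :
    A.mode v (-(k : ℤ)) (A.mode A.conf 0 b) + (k : ℂ) • A.mode v (-(k : ℤ) - 1) b +
      ((e : ℂ) + k - 1 + w) • A.mode v (-(k : ℤ)) b ∈ A.OL := by
  have h := A.add_mem_OL (A.mode v (-(k : ℤ)) b)
  rw [conf_zero_mode, A.mem_weightSpace.1 (A.mode_mem_weightSpace hv hb _ rfl)] at h
  convert h using 2
  · push_cast
    rw [neg_neg]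
  · push_cast
    congr 1
    ring

section Reduction

variable {n : ℕ} {u v : V} {d e : ℤ} {T : Submodule ℂ V}

/-- One step of the spanning argument: a factor `u_{-K}`, `K ≥ 2n + 2`, in front. -/
theorem mode_monoOp_cons_mem (hu : u ∈ A.weightSpace d) (hd : -(n : ℤ) ≤ d)
    (hsub : A.IsVertexSubalgebra (A.Vu u)) (hv : ∀ j : ℤ, 0 ≤ j → A.mode u j v = 0)
    (hO : A.O n ≤ T) {q : ℤ} {K : ℕ} (hK : 2 * n + 1 ≤ K) {l : List ℕ}
    (ih : ∀ b ∈ A.Vu u, ∀ w < listWeight d (K :: l), b ∈ A.weightSpace w → A.mode v q b ∈ T) :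
    A.mode v q (A.monoOp u (K :: l) A.vac) ∈ T := by
  obtain ⟨S, hS⟩ := Int.eq_ofNat_of_zero_le (show 0 ≤ d + n by omega)
  obtain ⟨m, rfl⟩ := Nat.exists_eq_add_of_le hK
  have h := hO (A.mode_add_sum_mem_O m hu hS (A.mode v q (A.monoOp u l A.vac)))
  rw [Submodule.add_mem_iff_left] at h
  · rw [A.monoOp_cons, Module.End.mul_apply, ← A.mode_commute_of_nonneg_eq_zero hv]
    convert h using 3
    push_cast
    ring
  -- The remaining modes may have nonnegative index. Closure of `V^u` under all modes keeps the
  -- result in `V^u`, with strictly smaller weight.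
  · refine Submodule.sum_mem _ fun i _ => Submodule.smul_mem _ _ ?_
    rw [A.mode_commute_of_nonneg_eq_zero hv]
    refine ih _ (hsub.2 _ (A.self_mem_posGen u) _ (A.monoOp_vac_mem u l) _) _ ?_
      (A.mode_mem_weightSpace hu (A.monoOp_vac_mem_weightSpace hu l) _ rfl)
    rw [listWeight_cons]
    push_cast
    omega

/-- The induction step on the weight in the spanning argument. -/
theorem mode_monoOp_mem_of_lt (hn : 1 ≤ n) (hu : u ∈ A.weightSpace d) (hd : -(n : ℤ) ≤ d)
    (hsub : A.IsVertexSubalgebra (A.Vu u)) (hperm : A.PermutationProperty {u} 1 (A.Vu u))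
    (hv : ∀ j : ℤ, 0 ≤ j → A.mode u j v = 0) (hve : v ∈ A.weightSpace e) (hO : A.O n ≤ T)
    (hT : ∀ (i : ℕ → ℕ) (k : ℕ), 1 ≤ k →
      A.ordProd u i (2 * n) (A.mode v (-(k : ℤ)) A.vac) ∈ T) {w : ℤ}
    (ih : ∀ b ∈ A.Vu u, ∀ w' < w, b ∈ A.weightSpace w' → ∀ k : ℕ, 1 ≤ k →
      A.mode v (-(k : ℤ)) b ∈ T) {k : ℕ} (hk : 1 ≤ k) (r : ℕ) :
    ∀ l : List ℕ, l.length = r → listWeight d l = w →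
      A.mode v (-(k : ℤ)) (A.monoOp u l A.vac) ∈ T := by
  -- At fixed weight `w` the induction is on length, so by `hlow` and `hper` factors may be
  -- reordered freely.
  induction r using Nat.strong_induction_on with
  | _ r ihr =>
  have hlow : ∀ f ∈ A.lower u r A.vac, f ∈ A.weightSpace w → A.mode v (-(k : ℤ)) f ∈ T :=
    fun f hf hfw => A.apply_mem_of_mem_span_monoOp hu hf hfw
      fun l hl hlw => ihr l.length hl l rfl hlw
  have hper : ∀ l l' : List ℕ, l.Perm l' → l.length = r → listWeight d l = w →
      A.mode v (-(k : ℤ)) (A.monoOp u l' A.vac) ∈ T →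
        A.mode v (-(k : ℤ)) (A.monoOp u l A.vac) ∈ T := by
    intro l l' hl hlr hlw h
    have h1 := A.monoOp_sub_mem_lower hperm (A.vac_mem_posGen u) hl
    rw [hlr] at h1
    have h2 := hlow _ h1 (by
      subst hlw
      refine sub_mem (A.monoOp_vac_mem_weightSpace hu l) ?_
      rw [listWeight_perm d hl]
      exact A.monoOp_vac_mem_weightSpace hu l')
    rw [map_sub] at h2
    exact (Submodule.sub_mem_iff_left _ h).1 h2
  have hbig : ∀ l : List ℕ, (∃ K ∈ l, 2 * n + 1 ≤ K) → l.length = r → listWeight d l = w →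
      A.mode v (-(k : ℤ)) (A.monoOp u l A.vac) ∈ T := by
    rintro l ⟨K, hKl, hK⟩ hlr hlw
    have hp := List.perm_cons_erase hKl
    refine hper _ _ hp hlr hlw (A.mode_monoOp_cons_mem hu hd hsub hv hO hK ?_)
    rw [← listWeight_perm d hp, hlw]
    exact fun b hb w' hw' hbw => ih b hb w' hw' hbw k hk
  -- Innermost induction, on the number `c` of factors `u_{-2n-1}`, which are the entries `2 * n`.
  have main : ∀ (c : ℕ) (l : List ℕ), l.count (2 * n) = c → l.length = r →
      listWeight d l = w → A.mode v (-(k : ℤ)) (A.monoOp u l A.vac) ∈ T := by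
    intro c
    induction c with
    | zero =>
      intro l hc hlr hlw
      by_cases hb : ∃ K ∈ l, 2 * n + 1 ≤ K
      · exact hbig l hb hlr hlw
      push Not at hb
      have hlt : ∀ j ∈ l, j < 2 * n := fun j hj =>
        lt_of_le_of_ne (Nat.le_of_lt_succ (hb j hj)) fun h =>
          List.count_eq_zero.1 hc (h ▸ hj)
      refine hper _ _ (VertexAlgebra.perm_ordList_of_lt hlt) hlr hlw ?_
      rw [← A.monoOp_mode_comm hv, ← A.ordProd_eq_monoOp]
      exact hT _ _ hk
    | succ c ihc =>
      intro l hc hlr hlw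
      by_cases hb : ∃ K ∈ l, 2 * n + 1 ≤ K
      · exact hbig l hb hlr hlw
      push Not at hb
      have hmem : 2 * n ∈ l := List.count_pos_iff.1 (by omega)
      have hp := List.perm_cons_erase hmem
      refine hper _ _ hp hlr hlw ?_
      have hl₀ : ∀ j ∈ l.erase (2 * n), j < 2 * n + 1 := fun j hj =>
        hb j (List.mem_of_mem_erase hj)
      have hc₀ : (l.erase (2 * n)).count (2 * n) = c := by
        rw [List.count_erase_self, hc, Nat.add_sub_cancel]
      have hlr₀ : (l.erase (2 * n)).length + 1 = r := by rw [← hlr, hp.length_eq]; simp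
      have hlw₀ : listWeight d ((2 * n - 1) :: l.erase (2 * n)) + 1 = w := by
        rw [← hlw, listWeight_perm d hp]
        simp only [listWeight_cons]
        push_cast [Nat.cast_sub (show 1 ≤ 2 * n by omega)]
        ring
      generalize l.erase (2 * n) = l₀ at *
      have hlt : ∀ j ∈ (2 * n - 1) :: l₀, j < 2 * n + 1 := by
        intro j hj
        rcases List.mem_cons.1 hj with rfl | hj
        · omega
        · exact hl₀ j hj
      -- One factor `u_{-2n-1}` is lowered to `u_{-2n}`, and `L(-1)` is applied to the resulting
      -- monomial of weight `w - 1`.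
      have herr := hlow _ (by
          have := A.err_le_lower _ _ _ (A.conf_zero_monoOp_vac hperm _ hlt)
          rwa [List.length_cons, hlr₀] at this)
        (hlw₀ ▸ A.conf_zero_error_mem_weightSpace hu _)
      have hP := A.monoOp_vac_mem_weightSpace hu ((2 * n - 1) :: l₀)
      have hPm := A.monoOp_vac_mem u ((2 * n - 1) :: l₀)
      have hD : A.mode v (-(k : ℤ))
          (A.mode A.conf 0 (A.monoOp u ((2 * n - 1) :: l₀) A.vac)) ∈ T := by
        -- The other two terms of this relation apply `v_{-k-1}` and `v_{-k}` to a vector of weight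
        -- `w - 1`. The shift of `k` is why `ih` covers all `k`.
        have h1 := hO (Submodule.mem_sup_left (A.mode_conf_zero_mem hve hP k))
        have h2 := ih _ hPm _ (by omega) hP (k + 1) (by omega)
        have h3 := ih _ hPm _ (by omega) hP k hk
        have e1 : -((k + 1 : ℕ) : ℤ) = -(k : ℤ) - 1 := by push_cast; ring
        rw [e1] at h2
        rwa [Submodule.add_mem_iff_left _ (Submodule.smul_mem _ _ h3),
          Submodule.add_mem_iff_left _ (Submodule.smul_mem _ _ h2)] at h1
      rw [map_sub, Submodule.sub_mem_iff_right _ hD, map_sum] at herr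
      -- Raising the entry `2n` creates a factor `u_{-2n-2}`, covered by `hbig`. Raising a smaller
      -- entry other than `2n - 1` leaves only `c` entries `2n`.
      have hterm : ∀ j ∈ Finset.range (2 * n + 1), j ≠ 2 * n - 1 →
          A.mode v (-(k : ℤ)) ((((j : ℂ) + 1) * (((2 * n - 1) :: l₀).count j : ℕ)) •
            A.monoOp u ((j + 1) :: ((2 * n - 1) :: l₀).erase j) A.vac) ∈ T := by
        intro j hj hj1
        rw [Finset.mem_range] at hj
        rw [map_smul]
        by_cases hjm : j ∈ (2 * n - 1) :: l₀
        · refine Submodule.smul_mem _ _ ?_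
          have hr : ((j + 1) :: ((2 * n - 1) :: l₀).erase j).length = r := by
            rw [List.length_cons, List.length_erase_of_mem hjm, List.length_cons]
            omega
          have hw' : listWeight d ((j + 1) :: ((2 * n - 1) :: l₀).erase j) = w := by
            rw [listWeight_cons_erase d hjm, hlw₀]
          by_cases hj2 : j = 2 * n
          · exact hbig _ ⟨j + 1, by simp, by omega⟩ hr hw'
          · refine ihc _ ?_ hr hw'
            rw [List.count_cons_of_ne (by omega), List.count_erase_of_ne (by omega),
              List.count_cons_of_ne (by omega), hc₀]
        · simp [List.count_eq_zero.2 hjm]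
      -- The remaining term is the wanted monomial, with coefficient `2n` times the number of
      -- entries `2n - 1`, which is nonzero.
      have hmem1 : 2 * n - 1 ∈ Finset.range (2 * n + 1) := Finset.mem_range.2 (by omega)
      rw [← Finset.add_sum_erase _ _ hmem1, Submodule.add_mem_iff_left _
        (Submodule.sum_mem _ fun j hj =>
          hterm j (Finset.mem_of_mem_erase hj) (Finset.ne_of_mem_erase hj)), map_smul,
        Submodule.smul_mem_iff, List.erase_cons_head, Nat.sub_add_cancel (by omega)] at herr
      · exact herr
      · rw [List.count_cons_self]
        exact mul_ne_zero (Nat.cast_add_one_ne_zero _) (Nat.cast_ne_zero.2 (Nat.succ_ne_zero _))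
  exact fun l hlr hlw => main _ l rfl hlr hlw

/-- If a subspace contains `O_n(V)` and all `u_{-2n}^{i_{2n}} ⋯ u_{-1}^{i_1} v_{-k} 𝟏`, then it
contains `v_{-k} V^u`. -/
theorem mode_mem_of_ordProd_mem (hn : 1 ≤ n) (hu : u ∈ A.weightSpace d) (hd : -(n : ℤ) ≤ d)
    (hsub : A.IsVertexSubalgebra (A.Vu u)) (hperm : A.PermutationProperty {u} 1 (A.Vu u))
    (hv : ∀ j : ℤ, 0 ≤ j → A.mode u j v = 0) (hve : v ∈ A.weightSpace e) (hO : A.O n ≤ T)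
    (hT : ∀ (i : ℕ → ℕ) (k : ℕ), 1 ≤ k →
      A.ordProd u i (2 * n) (A.mode v (-(k : ℤ)) A.vac) ∈ T) (l : List ℕ) {k : ℕ} (hk : 1 ≤ k) :
    A.mode v (-(k : ℤ)) (A.monoOp u l A.vac) ∈ T := by
  obtain ⟨N, hN⟩ := A.bounded
  -- Induction on the weight above the lower bound `N`; at `t = 0` the weight spaces vanish.
  have key : ∀ t : ℕ, ∀ b ∈ A.Vu u, ∀ w < N + t, b ∈ A.weightSpace w → ∀ k : ℕ, 1 ≤ k →
      A.mode v (-(k : ℤ)) b ∈ T := by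
    intro t
    induction t with
    | zero =>
      intro b _ w hw hb k _
      have : b ∈ A.weightSpace w := hb
      rw [weightSpace, hN w (by simpa using hw), Submodule.mem_bot] at this
      simp [this]
    | succ t iht =>
      intro b hb w hw hbw k hk
      rw [Vu, A.posGen_singleton] at hb
      refine A.apply_mem_of_mem_span_monoOp hu (P := fun _ => True) ?_ hbw fun l _ hlw =>
        A.mode_monoOp_mem_of_lt hn hu hd hsub hperm hv hve hO hT
          (fun b hb w' hw' => iht b hb w' (by push_cast at hw; omega)) hk l.length l rfl hlw
      convert hb using 2
      ext x
      simp [eq_comm]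
  have hlt : listWeight d l < N + ((listWeight d l - N).toNat + 1 : ℕ) := by omega
  exact key _ _ (A.monoOp_vac_mem u l) _ hlt (A.monoOp_vac_mem_weightSpace hu l) k hk

end Reduction

end VertexOperatorAlgebra

/-! ### Explicit reduction of powers of `u_{-2n-1}`; here `N = 2n - 1`. -/

namespace VertexOperatorAlgebra

open Function VertexAlgebra

variable {V : Type*} [AddCommGroup V] [Module ℂ V] (A : VertexOperatorAlgebra V)

section Counting

variable {i i₁ : ℕ → ℕ} {N : ℕ}

/-- `i₁` replaces one `u_{-N-2}` of the monomial `i` by `u_{-N-1}`, so raising one entry `N`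
restores it. -/
theorem perm_lower_top (hi : 1 ≤ i (N + 2))
    (h₁ : i₁ = update (update i (N + 2) (i (N + 2) - 1)) (N + 1) (i (N + 1) + 1)) :
    ((N + 1) :: (ordList i₁ (N + 2)).erase N).Perm (ordList i (N + 2)) := by
  subst h₁
  rw [List.perm_iff_count]
  intro x
  simp only [List.count_cons, List.count_erase, count_ordList, beq_iff_eq, update_apply]
  grind

/-- Raising `u_{-N-2}` gives `u_{-N-3}`, beyond the range of the ordered product, so it stays in
front. The bound on `i (N + 2)` makes the natural subtraction of `2` exact. -/
theorem perm_lower_two (hi : 2 ≤ i (N + 2))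
    (h₁ : i₁ = update (update i (N + 2) (i (N + 2) - 1)) (N + 1) (i (N + 1) + 1)) :
    ((N + 2) :: (ordList i₁ (N + 2)).erase (N + 1)).Perm ((N + 2) ::
      ordList (update (update i (N + 2) (i (N + 2) - 2)) (N + 1) (i (N + 1) + 1)) (N + 2)) := by
  subst h₁
  rw [List.perm_iff_count]
  intro x
  simp only [List.count_cons, List.count_erase, count_ordList, beq_iff_eq, update_apply]
  grind

theorem perm_raise {j : ℕ} (hj : j < N) (hi : 1 ≤ i₁ (j + 1)) :
    ((j + 1) :: (ordList i₁ (N + 2)).erase j).Perm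
      (ordList (update (update i₁ (j + 2) (i₁ (j + 2) + 1)) (j + 1) (i₁ (j + 1) - 1))
        (N + 2)) := by
  rw [List.perm_iff_count]
  intro x
  simp only [List.count_cons, List.count_erase, count_ordList, beq_iff_eq, update_apply]
  grind

end Counting

/-- The action of `L(-1)` on ordered monomials of `V^u`. -/
theorem conf_zero_ordProd_vac {u : V} (hperm : A.PermutationProperty {u} 1 (A.Vu u)) {N : ℕ}
    {i i₁ : ℕ → ℕ} (hi : 1 ≤ i (N + 2))
    (h₁ : i₁ = update (update i (N + 2) (i (N + 2) - 1)) (N + 1) (i (N + 1) + 1)) :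
    A.mode A.conf 0 (A.ordProd u i₁ (N + 2) A.vac) -
      ((∑ j ∈ Finset.Icc 1 N, ((j : ℂ) * (i j : ℂ)) • A.ordProd u
          (update (update i₁ (j + 1) (i₁ (j + 1) + 1)) j (i j - 1)) (N + 2) A.vac) +
        (((N : ℂ) + 1) * (i (N + 1) + 1)) • A.ordProd u i (N + 2) A.vac +
        (((N : ℂ) + 2) * ((i (N + 2) : ℂ) - 1)) • A.mode u (-((N : ℤ) + 3)) (A.ordProd u
          (update (update i (N + 2) (i (N + 2) - 2)) (N + 1) (i (N + 1) + 1)) (N + 2) A.vac)) ∈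
      A.err u (∑ j ∈ Finset.Icc 1 (N + 2), i j) A.vac := by
  have hlen : (ordList i₁ (N + 2)).length = ∑ j ∈ Finset.Icc 1 (N + 2), i j := by
    rw [← length_ordList, ← (perm_lower_top hi h₁).length_eq, List.length_cons,
      List.length_erase_add_one]
    rw [← List.count_pos_iff, count_ordList]
    simp [h₁]
  have hmain := A.conf_zero_monoOp_vac hperm (N := N + 2) (ordList i₁ (N + 2)) (by
    intro k hk
    rw [← List.count_pos_iff, count_ordList] at hk
    by_contra h
    simp [h] at hk)
  have hswap : ∀ {j : ℕ} {l : List ℕ}, j ∈ ordList i₁ (N + 2) →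
      ((j + 1) :: (ordList i₁ (N + 2)).erase j).Perm l →
        A.monoOp u ((j + 1) :: (ordList i₁ (N + 2)).erase j) A.vac - A.monoOp u l A.vac ∈
          A.err u (∑ j ∈ Finset.Icc 1 (N + 2), i j) A.vac := by
    intro j l hj hl
    have := A.monoOp_sub_mem_err hperm (A.vac_mem_posGen u) hl
    rwa [List.length_cons, List.length_erase_add_one hj, hlen] at this
  have hval : ∀ j < N, i₁ (j + 1) = i (j + 1) := by
    intro j hj
    rw [h₁, update_of_ne (by omega), update_of_ne (by omega)]
  have hlow : ∀ j ∈ Finset.range N,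
      (((j : ℂ) + 1) * (i (j + 1) : ℕ)) •
        (A.monoOp u ((j + 1) :: (ordList i₁ (N + 2)).erase j) A.vac -
          A.ordProd u (update (update i₁ (j + 1 + 1) (i₁ (j + 1 + 1) + 1)) (j + 1)
            (i (j + 1) - 1)) (N + 2) A.vac) ∈
          A.err u (∑ j ∈ Finset.Icc 1 (N + 2), i j) A.vac := by
    intro j hj
    rw [Finset.mem_range] at hj
    -- When the exponent is zero, the subtraction truncates, but the coefficient vanishes.
    rcases Nat.eq_zero_or_pos (i (j + 1)) with h0 | h0
    · simp [h0]
    · have hj₁ : 1 ≤ i₁ (j + 1) := by rw [hval j hj]; exact h0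
      rw [ordProd_eq_monoOp, ← hval j hj]
      refine Submodule.smul_mem _ _ (hswap ?_ (perm_raise hj hj₁))
      rw [← List.count_pos_iff, count_ordList, if_pos (by omega)]
      exact hj₁
  have hlow := Submodule.sum_mem _ hlow
  have hmid := Submodule.smul_mem _ (((N : ℂ) + 1) * (i (N + 1) + 1))
    (hswap (by
      rw [← List.count_pos_iff, count_ordList]
      simp [h₁]) (perm_lower_top hi h₁))
  have htop : (((N : ℂ) + 2) * ((i (N + 2) : ℂ) - 1)) •
        (A.monoOp u ((N + 2) :: (ordList i₁ (N + 2)).erase (N + 1)) A.vac -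
          A.monoOp u ((N + 2) :: ordList (update (update i (N + 2) (i (N + 2) - 2)) (N + 1)
            (i (N + 1) + 1)) (N + 2)) A.vac) ∈
          A.err u (∑ j ∈ Finset.Icc 1 (N + 2), i j) A.vac := by
    -- For `i (N + 2) = 1` the coefficient is zero, so the truncated exponent does no harm.
    rcases Nat.lt_or_ge (i (N + 2)) 2 with h2 | h2
    · have : i (N + 2) = 1 := by omega
      simp [this]
    · refine Submodule.smul_mem _ _ (hswap ?_ (perm_lower_two h2 h₁))
      rw [← List.count_pos_iff, count_ordList]
      simp [h₁]
      omega
  rw [hlen] at hmain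
  convert add_mem (add_mem (add_mem hmain hlow) hmid) htop using 1
  have hIcc : ∀ g : ℕ → V, ∑ j ∈ Finset.Icc 1 N, g j = ∑ j ∈ Finset.range N, g (j + 1) := by
    intro g
    rw [Finset.range_eq_Ico, Finset.sum_Ico_add' g 0 N 1]
    rfl
  have hc : ∀ j ∈ Finset.range N, (((j : ℂ) + 1) * ((ordList i₁ (N + 2)).count j : ℕ)) •
      A.monoOp u ((j + 1) :: (ordList i₁ (N + 2)).erase j) A.vac =
        (((j : ℂ) + 1) * (i (j + 1) : ℕ)) •
          A.monoOp u ((j + 1) :: (ordList i₁ (N + 2)).erase j) A.vac := by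
    intro j hj
    rw [Finset.mem_range] at hj
    rw [count_ordList, if_pos (by omega), hval j hj]
  have hcN : (ordList i₁ (N + 2)).count N = i (N + 1) + 1 := by
    rw [count_ordList]
    simp [h₁]
  have hcN1 : (((ordList i₁ (N + 2)).count (N + 1) : ℕ) : ℂ) = i (N + 2) - 1 := by
    rw [count_ordList]
    simp [h₁, Nat.cast_sub hi]
  rw [Finset.sum_range_succ, Finset.sum_range_succ, Finset.sum_congr rfl hc, hIcc, hcN, hcN1]
  simp only [smul_sub, Finset.sum_sub_distrib]
  rw [A.monoOp_cons u (N + 2), Module.End.mul_apply, A.monoOp_cons u (N + 2),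
    Module.End.mul_apply]
  simp only [ordProd_eq_monoOp]
  push_cast
  have e3 : -((N : ℤ) + 2 + 1) = -((N : ℤ) + 3) := by ring
  have e4 : ((N : ℂ) + 1 + 1) = N + 2 := by ring
  rw [e3, e4]
  abel

theorem listWeight_lower_top (d : ℤ) {i i₁ : ℕ → ℕ} {N : ℕ} (hi : 1 ≤ i (N + 2))
    (h₁ : i₁ = update (update i (N + 2) (i (N + 2) - 1)) (N + 1) (i (N + 1) + 1)) :
    listWeight d (ordList i₁ (N + 2)) + 1 =
      ∑ j ∈ Finset.Icc 1 (N + 2), (i j : ℤ) * (d + j - 1) := by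
  rw [← listWeight_ordList, ← listWeight_perm d (perm_lower_top hi h₁), listWeight_cons_erase]
  rw [← List.count_pos_iff, count_ordList]
  simp [h₁]

/-- Substitution `i = S - j` and symmetry of the binomial coefficients bring the circle relation for
`u_{-2n-2}` into the form used in the reduction formula. -/
theorem sum_choose_mode_reflect (n : ℕ) (d : ℤ) (S : ℕ) (hS : d + n = S) (u b : V) :
    ∑ j ∈ Finset.Icc 1 S, ((S.choose (j - 1) : ℕ) : ℂ) • A.mode u (d - n - j - 1) b =
      ∑ i ∈ Finset.range S,
        ((S.choose (i + 1) : ℕ) : ℂ) • A.mode u ((i : ℤ) + 1 - (2 * n + 2)) b := by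
  refine Finset.sum_nbij' (fun j => S - j) (fun i => S - i) ?_ ?_ ?_ ?_ ?_
  · intro j hj
    simp only [Finset.mem_Icc, Finset.mem_range] at *
    omega
  · intro j hj
    simp only [Finset.mem_Icc, Finset.mem_range] at *
    omega
  · intro j hj
    simp only [Finset.mem_Icc] at hj
    omega
  · intro j hj
    simp only [Finset.mem_range] at hj
    omega
  · intro j hj
    simp only [Finset.mem_Icc] at hj
    rw [← Nat.choose_symm (show j - 1 ≤ S by omega), show S - (j - 1) = S - j + 1 by omega]
    congr 3
    omega

end VertexOperatorAlgebra

namespace VertexOperatorAlgebra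

open Function VertexAlgebra

variable {V : Type*} [AddCommGroup V] [Module ℂ V] (A : VertexOperatorAlgebra V)

theorem ordProd_mode_comm {u v : V} (hv : ∀ j : ℤ, 0 ≤ j → A.mode u j v = 0) (i : ℕ → ℕ)
    (N : ℕ) (q : ℤ) (c : V) :
    A.ordProd u i N (A.mode v q c) = A.mode v q (A.ordProd u i N c) := by
  rw [ordProd_eq_monoOp, A.monoOp_mode_comm hv]

theorem mode_mem_lower_of_comm {u v : V} (hv : ∀ j : ℤ, 0 ≤ j → A.mode u j v = 0) (q : ℤ) {r : ℕ}
    {f c : V} (hf : f ∈ A.lower u r c) : A.mode v q f ∈ A.lower u r (A.mode v q c) := by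
  refine (Submodule.span_le (p := (A.lower u r (A.mode v q c)).comap (A.mode v q))).2 ?_ hf
  rintro _ ⟨l, hl, rfl⟩
  exact Submodule.subset_span ⟨l, hl, (A.monoOp_mode_comm hv l q c).symm⟩

/-- The reduction of `u_{-2n-1} v_{-k} 𝟏` modulo `O^L(V)`. -/
theorem mode_mode_vac_reduction {n : ℕ} (hn : 1 ≤ n) {u v : V} {d e : ℤ}
    (hu : u ∈ A.weightSpace d) (hv : v ∈ A.weightSpace e) (k : ℕ) :
    A.mode u (-(2 * (n : ℤ) + 1)) (A.mode v (-(k : ℤ)) A.vac) -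
        (-(((d : ℂ) + e + 2 * n + k - 2) / (2 * n)) •
            A.mode u (-(2 * (n : ℤ))) (A.mode v (-(k : ℤ)) A.vac) -
          ((k : ℂ) / (2 * n)) •
            A.mode u (-(2 * (n : ℤ))) (A.mode v (-(k : ℤ) - 1) A.vac)) ∈ A.OL := by
  -- `L(-1)` applied to `u_{-2n} v_{-k} 𝟏` produces `2n u_{-2n-1} v_{-k} 𝟏 + k u_{-2n} v_{-k-1} 𝟏`,
  -- and `L(0)` acts by the weight; dividing by `2n` gives the claim.
  have h := A.add_mem_OL (A.mode u (-(2 * (n : ℤ))) (A.mode v (-(k : ℤ)) A.vac))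
  rw [conf_zero_mode, conf_zero_mode, conf_zero_vac, A.mem_weightSpace.1
    (A.mode_mem_weightSpace hu (A.mode_mem_weightSpace hv A.vac_mem_weightSpace _ rfl) _ rfl)] at h
  have hn' : (n : ℂ) ≠ 0 := Nat.cast_ne_zero.2 (by omega)
  rw [show -(2 * (n : ℤ)) - 1 = -(2 * (n : ℤ) + 1) by ring] at h
  convert A.OL.smul_mem (1 / (2 * (n : ℂ))) h using 1
  simp only [map_zero, zero_add, map_smul]
  push_cast
  match_scalars
  · field_simp
  · field_simp
    ring
  · field_simp

/-- The reduction of powers of `u_{-2n-1}` modulo `O_n(V)`. -/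
theorem ordProd_reduction {n : ℕ} (hn : 1 ≤ n) {u v : V} {d e : ℤ}
    (hu : u ∈ A.weightSpace d) (hd : -(n : ℤ) ≤ d)
    (hperm : A.PermutationProperty {u} 1 (A.Vu u))
    (hv : ∀ j : ℤ, 0 ≤ j → A.mode u j v = 0) (hve : v ∈ A.weightSpace e)
    {i i₁ i₂ : ℕ → ℕ} (k : ℕ) (hi : 1 ≤ i (2 * n + 1))
    (h₁ : i₁ = update (update i (2 * n + 1) (i (2 * n + 1) - 1)) (2 * n) (i (2 * n) + 1))
    (h₂ : i₂ = update (update i (2 * n + 1) (i (2 * n + 1) - 2)) (2 * n) (i (2 * n) + 1)) :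
    ∃ f ∈ A.filt {u} 1 ((∑ j ∈ Finset.Icc 1 (2 * n + 1), i j) - 1) (A.mode v (-(k : ℤ)) A.vac),
      ((∀ p q : ℤ, 1 ≤ p → 1 ≤ q → Commute (A.mode u (-p)) (A.mode u (-q))) → f = 0) ∧
      A.ordProd u i (2 * n + 1) (A.mode v (-(k : ℤ)) A.vac) -
        (-(1 / (2 * (n : ℂ) * ((i (2 * n) : ℂ) + 1)))) •
          (((e : ℂ) + k - 1 - 1 +
                ∑ j ∈ Finset.Icc 1 (2 * n + 1), (i j : ℂ) * ((d : ℂ) + j - 1)) •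
              A.ordProd u i₁ (2 * n + 1) (A.mode v (-(k : ℤ)) A.vac)
            - ((2 * (n : ℂ) + 1) * ((i (2 * n + 1) : ℂ) - 1)) •
                (∑ j ∈ Finset.Icc 1 ((n : ℤ) + d).toNat,
                  ((((n : ℤ) + d).toNat.choose (j - 1) : ℕ) : ℂ) •
                    A.mode u (d - n - j - 1)
                      (A.ordProd u i₂ (2 * n + 1) (A.mode v (-(k : ℤ)) A.vac)))
            + (∑ j ∈ Finset.Icc 1 (2 * n - 1),
                ((j : ℂ) * (i j : ℂ)) •
                  A.ordProd u
                    (update (update i₁ (j + 1) (i₁ (j + 1) + 1)) j (i j - 1))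
                    (2 * n + 1) (A.mode v (-(k : ℤ)) A.vac))
            + (k : ℂ) • A.ordProd u i₁ (2 * n + 1) (A.mode v (-(k : ℤ) - 1) A.vac)
            + f) ∈ A.O n := by
  have e1 : 2 * n - 1 + 1 = 2 * n := by omega
  have e2 : 2 * n - 1 + 2 = 2 * n + 1 := by omega
  have e3 : ((2 * n - 1 : ℕ) : ℂ) = 2 * n - 1 := by
    rw [Nat.cast_sub (by omega)]
    push_cast
    ring
  have e4 : ((2 * n - 1 : ℕ) : ℤ) + 3 = 2 * n + 2 := by omega
  have hD := A.conf_zero_ordProd_vac hperm (N := 2 * n - 1) (i := i) (i₁ := i₁)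
    (by rwa [e2]) (by rw [e1, e2, h₁])
  have hwt := listWeight_lower_top d (N := 2 * n - 1) (i := i) (i₁ := i₁)
    (by rwa [e2]) (by rw [e1, e2, h₁])
  rw [e1, e2, e3, e4, ← h₂] at hD
  rw [e2] at hwt
  have hP := A.monoOp_vac_mem_weightSpace hu (ordList i₁ (2 * n + 1))
  rw [← ordProd_eq_monoOp] at hP
  have hsum : 1 ≤ ∑ j ∈ Finset.Icc 1 (2 * n + 1), i j :=
    hi.trans (Finset.single_le_sum (fun _ _ => Nat.zero_le _) (by simp))
  have hOL := (show A.OL ≤ A.O n from le_sup_left) (A.mode_conf_zero_mem hve hP k)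
  obtain ⟨S, hS⟩ := Int.eq_ofNat_of_zero_le (show 0 ≤ d + n by omega)
  have hS' : ((n : ℤ) + d).toNat = S := by omega
  have hO := A.mode_add_sum_mem_O (n := n) 0 hu hS
    (A.mode v (-(k : ℤ)) (A.ordProd u i₂ (2 * n + 1) A.vac))
  rw [Nat.cast_zero, add_zero, ← A.sum_choose_mode_reflect n d S hS] at hO
  -- The witness `f` is `v_{-k}` applied to the reordering error in `L(-1)` of the monomial `i₁`.
  refine ⟨A.mode v (-(k : ℤ)) (A.mode A.conf 0 (A.ordProd u i₁ (2 * n + 1) A.vac) -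
      ((∑ j ∈ Finset.Icc 1 (2 * n - 1), ((j : ℂ) * (i j : ℂ)) • A.ordProd u
          (update (update i₁ (j + 1) (i₁ (j + 1) + 1)) j (i j - 1)) (2 * n + 1) A.vac) +
        ((2 * (n : ℂ) - 1 + 1) * (i (2 * n) + 1)) • A.ordProd u i (2 * n + 1) A.vac +
        ((2 * (n : ℂ) - 1 + 2) * ((i (2 * n + 1) : ℂ) - 1)) •
          A.mode u (-(2 * (n : ℤ) + 2)) (A.ordProd u i₂ (2 * n + 1) A.vac))), ?_, fun hc => ?_, ?_⟩
  · rw [A.filt_singleton, Nat.sub_add_cancel hsum]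
    exact A.mode_mem_lower_of_comm hv _ (A.err_le_lower _ _ _ hD)
  · rw [A.eq_zero_of_mem_err hD hc, map_zero]
  · simp only [A.ordProd_mode_comm hv, hS']
    -- The `O^L` relation for `i₁` contains `(2n+1)(i_{2n+1}-1) u_{-2n-2}` applied to the monomial
    -- `i₂`. Subtracting that multiple of the circle relation removes it, and division by
    -- `2n(i_{2n}+1)` normalizes the term for `i`.
    convert Submodule.smul_mem _ (1 / (2 * (n : ℂ) * ((i (2 * n) : ℂ) + 1)))
      (sub_mem hOL (Submodule.smul_mem _ ((2 * (n : ℂ) + 1) * ((i (2 * n + 1) : ℂ) - 1)) hO))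
      using 1
    have hwt' : ∑ j ∈ Finset.Icc 1 (2 * n + 1), (i j : ℂ) * ((d : ℂ) + j - 1) =
        listWeight d (ordList i₁ (2 * n + 1)) + 1 := by exact_mod_cast hwt.symm
    simp only [hwt', map_sub, map_add, map_sum, map_smul]
    rw [← A.mode_commute_of_nonneg_eq_zero hv (-(2 * (n : ℤ) + 2))]
    generalize A.mode v (-(k : ℤ)) (A.ordProd u i (2 * n + 1) A.vac) = P
    have ha : (1 / (2 * (n : ℂ) * ((i (2 * n) : ℂ) + 1))) * (2 * n * (i (2 * n) + 1)) = 1 :=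
      one_div_mul_cancel (mul_ne_zero
        (mul_ne_zero two_ne_zero (Nat.cast_ne_zero.2 (by omega))) (Nat.cast_add_one_ne_zero _))
    generalize 1 / (2 * (n : ℂ) * ((i (2 * n) : ℂ) + 1)) = a at *
    -- Inserting `a` times its inverse makes the identity linear over the ring generated by the
    -- symbols, so `module` can close it.
    have hP : P = a • (2 * (n : ℂ) * (i (2 * n) + 1)) • P := by rw [smul_smul, ha, one_smul]
    conv_lhs => enter [1]; rw [hP]
    module

end VertexOperatorAlgebra

/-! ### Assembly of the four statements. -/

theorem mainTheorem4 {V : Type*} [AddCommGroup V] [Module ℂ V] (A : VertexOperatorAlgebra V)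
    (n : ℕ) (hn : 1 ≤ n) (u : V) (d : ℤ) (hu : u ∈ A.weightSpace d) (hd : -(n : ℤ) ≤ d)
    (hsub : A.IsVertexSubalgebra (A.Vu u))
    (hperm : A.PermutationProperty {u} 1 (A.Vu u))
    (W : Set V)
    (hWhom : W ⊆ Submodule.span ℂ {w | w ∈ W ∧ ∃ e : ℤ, w ∈ A.weightSpace e})
    (hW : A.ActsStrongly {u} W) :
    -- generators of `A_n^u`
    A.Anu n u =
      A.zhuAdjoin n {x | ∃ i : ℕ → ℕ, x = A.cls n (A.ordProd u i (2 * n) A.vac)} ∧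
    -- spanning set for `A_n^u . W`
    A.AnuAct n u W ⊆
      Submodule.span ℂ {x | ∃ (i : ℕ → ℕ) (k : ℕ) (v : V), 1 ≤ k ∧ v ∈ W ∧
        x = A.cls n (A.ordProd u i (2 * n) (A.mode v (-(k : ℤ)) A.vac))} ∧
    -- reduction of `u_{-2n-1}` modulo `O^L(V)`
    (∀ (v : V) (e : ℤ) (k : ℕ), v ∈ W → v ∈ A.weightSpace e → 1 ≤ k →
      A.mode u (-(2 * (n : ℤ) + 1)) (A.mode v (-(k : ℤ)) A.vac) -
        (-(((d : ℂ) + e + 2 * n + k - 2) / (2 * n)) •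
            A.mode u (-(2 * (n : ℤ))) (A.mode v (-(k : ℤ)) A.vac) -
          ((k : ℂ) / (2 * n)) •
            A.mode u (-(2 * (n : ℤ))) (A.mode v (-(k : ℤ) - 1) A.vac)) ∈ A.OL) ∧
    -- reduction of powers of `u_{-2n-1}` modulo `O_n(V)`
    (∀ (v : V) (e : ℤ) (i : ℕ → ℕ) (k : ℕ), v ∈ W → v ∈ A.weightSpace e →
      1 ≤ k → 1 ≤ i (2 * n + 1) →
      -- `x = v_{-k} 𝟏`, `y = v_{-k-1} 𝟏`
      let x : V := A.mode v (-(k : ℤ)) A.vac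
      let y : V := A.mode v (-(k : ℤ) - 1) A.vac
      -- exponents with `i_{2n}` raised by one and `i_{2n+1}` lowered by one, resp. by two
      let i₁ : ℕ → ℕ := Function.update (Function.update i (2 * n + 1) (i (2 * n + 1) - 1))
        (2 * n) (i (2 * n) + 1)
      let i₂ : ℕ → ℕ := Function.update (Function.update i (2 * n + 1) (i (2 * n + 1) - 2))
        (2 * n) (i (2 * n) + 1)
      ∃ f ∈ A.filt {u} 1 ((∑ j ∈ Finset.Icc 1 (2 * n + 1), i j) - 1) x,
        ((∀ p q : ℤ, 1 ≤ p → 1 ≤ q → Commute (A.mode u (-p)) (A.mode u (-q))) → f = 0) ∧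
        A.ordProd u i (2 * n + 1) x -
          (-(1 / (2 * (n : ℂ) * ((i (2 * n) : ℂ) + 1)))) •
            (((e : ℂ) + k - 1 - 1 +
                  ∑ j ∈ Finset.Icc 1 (2 * n + 1), (i j : ℂ) * ((d : ℂ) + j - 1)) •
                A.ordProd u i₁ (2 * n + 1) x
              - ((2 * (n : ℂ) + 1) * ((i (2 * n + 1) : ℂ) - 1)) •
                  (∑ j ∈ Finset.Icc 1 ((n : ℤ) + d).toNat,
                    ((((n : ℤ) + d).toNat.choose (j - 1) : ℕ) : ℂ) •
                      A.mode u (d - n - j - 1) (A.ordProd u i₂ (2 * n + 1) x))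
              + (∑ j ∈ Finset.Icc 1 (2 * n - 1),
                  ((j : ℂ) * (i j : ℂ)) •
                    A.ordProd u
                      (Function.update (Function.update i₁ (j + 1) (i₁ (j + 1) + 1)) j (i j - 1))
                      (2 * n + 1) x)
              + (k : ℂ) • A.ordProd u i₁ (2 * n + 1) y
              + f) ∈ A.O n) := by
  have hu₁ := A.self_mem_posGen u
  refine ⟨?_, ?_, fun v e k _ hve _ => A.mode_mode_vac_reduction hn hu hve k,
    fun v e i k hv hve _ hi => A.ordProd_reduction hn hu hd hperm
      (hW.2 u hu₁ v hv) hve k hi rfl rfl⟩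
  -- A subspace contains the classes of `V^u` exactly when it contains those of the ordered
  -- monomials, so both generated subalgebras are infima of the same family.
  · have hset : ∀ B : Submodule ℂ (A.Zhu n), A.cls n '' (A.Vu u : Set V) ⊆ B ↔
        {x | ∃ i : ℕ → ℕ, x = A.cls n (A.ordProd u i (2 * n) A.vac)} ⊆ (B : Set (A.Zhu n)) := by
      intro B
      constructor
      · rintro h _ ⟨i, rfl⟩
        refine h ⟨_, ?_, rfl⟩
        rw [A.ordProd_eq_monoOp]
        exact A.monoOp_vac_mem u _
      · rintro h _ ⟨b, hb, rfl⟩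
        rw [VertexOperatorAlgebra.Vu, SetLike.mem_coe, A.posGen_singleton] at hb
        refine (Submodule.span_le (p := B.comap (A.O n).mkQ)).2 ?_ hb
        rintro _ ⟨l, rfl⟩
        have hO : A.O n ≤ B.comap (A.O n).mkQ := fun x hx => by
          have : (A.O n).mkQ x = 0 := by simpa using hx
          rw [Submodule.mem_comap, this]
          exact B.zero_mem
        -- The vacuum plays the role of `v`: its mode `-1` is the identity and its other modes
        -- vanish.
        have := A.mode_mem_of_ordProd_mem (v := A.vac) hn hu hd hsub hperm
          (fun j hj => A.mode_vac_nonneg u j hj) A.vac_mem_weightSpace hO (fun i k _ => by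
            rw [A.mode_vac_apply]
            split_ifs
            · exact h ⟨i, rfl⟩
            · rw [map_zero]
              exact zero_mem _) l le_rfl
        rw [A.mode_vac_apply] at this
        simpa using this
    unfold VertexOperatorAlgebra.Anu VertexOperatorAlgebra.zhuAdjoin
    simp only [hset]
  · rintro _ ⟨v, hv, m, k, hk, rfl⟩
    rw [A.modeProd_eq_monoOp (fun _ => rfl) hk]
    generalize (List.ofFn fun i => (k i - 1).toNat) = l
    set B := Submodule.span ℂ {x | ∃ (i : ℕ → ℕ) (k : ℕ) (v : V), 1 ≤ k ∧ v ∈ W ∧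
        x = A.cls n (A.ordProd u i (2 * n) (A.mode v (-(k : ℤ)) A.vac))} with hB
    -- By linearity `v` may be replaced by a homogeneous `w ∈ W`, written as `w_{-1} 𝟏`.
    refine (Submodule.span_le (p := B.comap ((A.O n).mkQ ∘ₗ A.monoOp u l))).2 ?_ (hWhom hv)
    rintro w ⟨hw, e, hwe⟩
    have hO : A.O n ≤ B.comap (A.O n).mkQ := fun x hx => by
      have : (A.O n).mkQ x = 0 := by simpa using hx
      rw [Submodule.mem_comap, this]
      exact B.zero_mem
    have := A.mode_mem_of_ordProd_mem hn hu hd hsub hperm (hW.2 u hu₁ w hw) hwe hO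
      (fun i k hk => Submodule.subset_span ⟨i, k, w, hk, hw, rfl⟩) l le_rfl
    rw [← A.monoOp_mode_comm (hW.2 u hu₁ w hw)] at this
    have hw1 : A.mode w (-((1 : ℕ) : ℤ)) A.vac = w := A.mode_vac_neg_one w
    rwa [hw1] at this
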